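/- For a prime $\ell\ge 3$ and $j\in(\mathbb{Z}/\ell\mathbb{Z})^*$, let $\langle j\rangle_\ell$ be the representative of $j$ in $\{1,\dots,\ell-1\}$. For an integer $1\le k\le \ell-2$ put $$M_{k,\ell}=\{j\in(\mathbb{Z}/\ell\mathbb{Z})^* : \langle kj\rangle_\ell+\langle j\rangle_\ell<\ell\},\qquad W_{k,\ell}=\{w\in(\mathbb{Z}/\ell\mathbb{Z})^* : wM_{k,\ell}=M_{k,\ell}\},$$ let $E_{k,\ell}(a)=0$ if $a\in M_{k,\ell}$ and $E_{k,\ell}(a)=1$ if $a\notin M_{k,\ell}$, and define the Demjanenko matrix $$D_{k,\ell}=\left(E_{k,\ell}(-c^{-1}a)-\tfrac12\right)_{c,a\in M_{k,\ell}/W_{k,\ell}}.$$ Let $\mathcal{K}_\ell$ be the set of positive integers $k\le \ell-2$ for which $D_{k,\ell}$ is singular. Let $\ell\geq 3$ be a prime and let $\ell-1=2^\alpha 3^\beta m$ for some integers $\alpha,\beta>0$ and $m$ with $\gcd(m,6)=1$. If $\ell>441\cdot 2^{4\alpha}\beta^4$, then $\#\mathcal{K}_\ell>0$. -/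

import Mathlib

open scoped Pointwise

namespace Demjanenko

/-- The set `M_{k,ℓ}` of all `j ∈ (ℤ/ℓℤ)ˣ` with `⟨k j⟩ + ⟨j⟩ < ℓ`. For `k` prime to `ℓ` both `j` and
`k j` are nonzero, so that `ZMod.val` is the representative in the range `1, …, ℓ - 1`. -/
def M (k ℓ : ℕ) : Set (ZMod ℓ)ˣ :=
  {j | ((k : ZMod ℓ) * (j : ZMod ℓ)).val + (j : ZMod ℓ).val < ℓ}

/-- The subgroup `W_{k,ℓ}` of all `w ∈ (ℤ/ℓℤ)ˣ` with `w M_{k,ℓ} = M_{k,ℓ}`. -/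
def W (k ℓ : ℕ) : Subgroup (ZMod ℓ)ˣ :=
  MulAction.stabilizer (ZMod ℓ)ˣ (M k ℓ)

theorem mem_W {k ℓ : ℕ} {w : (ZMod ℓ)ˣ} : w ∈ W k ℓ ↔ w • M k ℓ = M k ℓ :=
  MulAction.mem_stabilizer_iff

open Classical in
/-- `E_{k,ℓ}(a)` is `0` if `a ∈ M_{k,ℓ}` and `1` otherwise. -/
noncomputable def E (k ℓ : ℕ) (a : (ZMod ℓ)ˣ) : ℚ :=
  if a ∈ M k ℓ then 0 else 1

theorem mul_mem_M_iff {k ℓ : ℕ} {w : (ZMod ℓ)ˣ} (hw : w ∈ W k ℓ) (a : (ZMod ℓ)ˣ) :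
    a * w ∈ M k ℓ ↔ a ∈ M k ℓ := by
  have h := Set.smul_mem_smul_set_iff (a := w) (s := M k ℓ) (x := a)
  rw [mem_W.1 hw, smul_eq_mul, mul_comm] at h
  exact h

theorem E_mul {k ℓ : ℕ} {w : (ZMod ℓ)ˣ} (hw : w ∈ W k ℓ) (a : (ZMod ℓ)ˣ) :
    E k ℓ (a * w) = E k ℓ a := by
  by_cases h : a ∈ M k ℓ
  · simp [E, h, (mul_mem_M_iff hw a).2 h]
  · simp [E, h, mt (mul_mem_M_iff hw a).1 h]

/-- The function on `(ℤ/ℓℤ)ˣ / W_{k,ℓ}` induced by `E_{k,ℓ}`. -/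
noncomputable def EQuot (k ℓ : ℕ) : (ZMod ℓ)ˣ ⧸ W k ℓ → ℚ :=
  Quotient.lift (E k ℓ) fun a b hab => by
    have h := E_mul (QuotientGroup.leftRel_apply.1 hab) a
    rw [mul_inv_cancel_left] at h
    exact h.symm

/-- The set `M_{k,ℓ} / W_{k,ℓ}` of the classes modulo `W_{k,ℓ}` of the elements of `M_{k,ℓ}`. -/
def MQuot (k ℓ : ℕ) : Set ((ZMod ℓ)ˣ ⧸ W k ℓ) :=
  (fun j : (ZMod ℓ)ˣ => (j : (ZMod ℓ)ˣ ⧸ W k ℓ)) '' M k ℓ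

/-- The Demjanenko matrix `D_{k,ℓ}`, with rows `c` and columns `a` in `M_{k,ℓ} / W_{k,ℓ}` and
entries `E_{k,ℓ}(-c⁻¹ a) - 1/2`. -/
noncomputable def D (k ℓ : ℕ) : Matrix (MQuot k ℓ) (MQuot k ℓ) ℚ :=
  Matrix.of fun c a =>
    EQuot k ℓ (((-1 : (ZMod ℓ)ˣ) : (ZMod ℓ)ˣ ⧸ W k ℓ) * c.1⁻¹ * a.1) - 1 / 2

/-- On representatives, the entries of `D_{k,ℓ}` are `E_{k,ℓ}(-c⁻¹ a) - 1/2`. -/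
theorem D_apply (k ℓ : ℕ) {c a : (ZMod ℓ)ˣ} (hc : c ∈ M k ℓ) (ha : a ∈ M k ℓ) :
    D k ℓ ⟨c, c, hc, rfl⟩ ⟨a, a, ha, rfl⟩ = E k ℓ (-c⁻¹ * a) - 1 / 2 := by
  rw [← neg_one_mul c⁻¹]
  rfl

noncomputable instance instFintypeMQuot (k ℓ : ℕ) [NeZero ℓ] : Fintype (MQuot k ℓ) :=
  Fintype.ofFinite _

open Classical in
/-- The set `𝒦_ℓ` of the positive integers `k ≤ ℓ - 2` for which `D_{k,ℓ}` is singular. -/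
def K (ℓ : ℕ) [NeZero ℓ] : Set ℕ :=
  {k | 0 < k ∧ k ≤ ℓ - 2 ∧ (D k ℓ).det = 0}

end Demjanenko

namespace Demjanenko

open Complex HurwitzZeta Filter Topology

/-! Write `saw x = ⟨x⟩/ℓ - 1/2`. Then `E - 1/2` is the sum of the dilates of `saw` by 1, k and
-(k+1) (`E_sub_half`), so pairing it with an odd character χ gives (1 + χ⁻¹(k) - χ⁻¹(k+1)) B, where
B = ∑ χ(u) saw(u). If the first factor vanishes and `W` is trivial, the restriction of χ to `M` is a
kernel vector of `D` (`det_D_eq_zero`).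

With y = k + 1 and p a primitive sixth root of unity, the conditions χ(y) = p and χ(1-y) = p⁻¹ turn
the factor into 1 - p - p⁻¹ = 0. A character of order 3·2^α takes these values and is odd, since its
order does not divide (ℓ-1)/2. Jacobi sums show that more than two such y exist
(`le_sq_mul_card_filter`).

Triviality of `W` rests on B ≠ 0 for every odd χ, that is, on L(1, χ) ≠ 0: the dilates of `saw` then
satisfy only the relations forced by oddness (`even_of_sum_mul_saw_eq_zero`). Hence `W` permutes {1,
k, -(k+1)}, which leaves only the exception k² + k + 1 = 0 (`W_eq_bot`). It excludes at most two y.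
-/

/-! ### The odd Hurwitz zeta function at s = 1. -/

/-- A summable majorant, uniform in s, for letting s tend to 1 under the sum. -/
theorem abs_rpow_neg_sub_rpow_neg_le {c N x y s : ℝ} (hc : 0 < c) (hc1 : c ≤ 1) (hN : 1 ≤ N)
    (hx : c * N ≤ x) (hy : c * N ≤ y) (hxy : |x - y| ≤ 1) (hs : 1 ≤ s) (hs2 : s ≤ 2) :
    |x ^ (-s) - y ^ (-s)| ≤ 2 * c⁻¹ ^ 3 * (1 / N ^ 2) := by
  wlog h : x ≤ y generalizing x y
  · rw [abs_sub_comm]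
    exact this hy hx (by rwa [abs_sub_comm]) (le_of_not_ge h)
  have hN0 : 0 < N := by linarith
  have hcN : 0 < c * N := by positivity
  have hx0 : 0 < x := hcN.trans_le hx
  have hy0 : 0 < y := hcN.trans_le hy
  have hmono : y ^ (-s) ≤ x ^ (-s) := Real.rpow_le_rpow_of_nonpos hx0 h (by linarith)
  rw [abs_of_nonneg (sub_nonneg.2 hmono)]
  -- Bernoulli's inequality plays the role of the mean value theorem.
  have hb : 1 + s * (x / y - 1) ≤ (x / y) ^ s := by
    have := one_add_mul_self_le_rpow_one_add (s := x / y - 1)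
      (by linarith [div_pos hx0 hy0]) hs
    simpa using this
  have hfac : y ^ (-s) = x ^ (-s) * (x / y) ^ s := by
    rw [Real.div_rpow hx0.le hy0.le, Real.rpow_neg hx0.le, Real.rpow_neg hy0.le]
    field_simp
  have hxs : x ^ (-s) ≤ c⁻¹ ^ 2 * N⁻¹ := by
    calc x ^ (-s) ≤ (c * N) ^ (-s) := Real.rpow_le_rpow_of_nonpos hcN hx (by linarith)
      _ = c ^ (-s) * N ^ (-s) := Real.mul_rpow hc.le hN0.le
      _ ≤ c ^ (-2 : ℝ) * N ^ (-1 : ℝ) := by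
        gcongr ?_ * ?_
        · exact Real.rpow_le_rpow_of_exponent_ge hc hc1 (by linarith)
        · exact Real.rpow_le_rpow_of_exponent_le hN (by linarith)
      _ = c⁻¹ ^ 2 * N⁻¹ := by
        rw [Real.rpow_neg hc.le, Real.rpow_neg hN0.le]
        norm_num
  have hxy' : s * (1 - x / y) ≤ 2 * (c⁻¹ * N⁻¹) := by
    have h1 : 1 - x / y = (y - x) * y⁻¹ := by field_simp
    have h2 : y⁻¹ ≤ (c * N)⁻¹ := by gcongr
    rw [mul_inv] at h2
    have h3 : y - x ≤ 1 := by rw [abs_sub_comm] at hxy; exact (le_abs_self _).trans hxy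
    have h4 : 1 - x / y ≤ c⁻¹ * N⁻¹ := by
      rw [h1]
      calc (y - x) * y⁻¹ ≤ 1 * (c⁻¹ * N⁻¹) := by gcongr
        _ = _ := one_mul _
    have h5 : 0 ≤ 1 - x / y := by rw [h1]; exact mul_nonneg (by linarith) (by positivity)
    gcongr
  have h6 : 0 ≤ s * (1 - x / y) :=
    mul_nonneg (by linarith) (sub_nonneg.2 ((div_le_one hy0).2 h))
  calc x ^ (-s) - y ^ (-s) = x ^ (-s) * (1 - (x / y) ^ s) := by rw [hfac]; ring
    _ ≤ x ^ (-s) * (s * (1 - x / y)) := by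
      gcongr
      linarith
    _ ≤ (c⁻¹ ^ 2 * N⁻¹) * (2 * (c⁻¹ * N⁻¹)) := by gcongr
    _ = _ := by field_simp

theorem hasSum_one_div_sub_one_div {a : ℝ} (ha0 : 0 < a) (ha1 : a < 1)
    (hsum : Summable fun n : ℕ => (1 / (n + a : ℂ) - 1 / (n + 1 - a : ℂ))) :
    HasSum (fun n : ℕ => (1 / (n + a : ℂ) - 1 / (n + 1 - a : ℂ))) (Real.pi * cot (Real.pi * a)) := by
  rw [hsum.hasSum_iff_tendsto_nat]
  have ha : (a : ℂ) ∈ integerComplement := by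
    rintro ⟨n, hn⟩
    have hn' : (n : ℝ) = a := by exact_mod_cast hn
    rw [← hn'] at ha0 ha1
    have h1 : 0 < n := by exact_mod_cast ha0
    have h2 : n < 1 := by exact_mod_cast ha1
    omega
  have h := tendsto_logDeriv_euler_cot_sub ha
  -- The cotangent series pairs a + (n+1) with a - (n+1), the series here n + a with n + 1 - a; the
  -- N-th partial sums, after adding 1/a to the former, differ by 1/(N + a).
  have h0 : Tendsto (fun n : ℕ => (1 / (n + a : ℂ))) atTop (𝓝 0) := by
    have : Tendsto (fun n : ℕ => ((1 / (n + a) : ℝ) : ℂ)) atTop (𝓝 ((0 : ℝ) : ℂ)) := by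
      refine (continuous_ofReal.tendsto 0).comp ?_
      refine Tendsto.const_div_atTop ?_ 1
      exact tendsto_atTop_add_const_right _ _ tendsto_natCast_atTop_atTop
    simpa using this
  have h' := (h.sub h0).add_const (1 / (a : ℂ))
  rw [sub_zero, sub_add_cancel] at h'
  refine h'.congr fun N => ?_
  induction N with
  | zero => simp
  | succ N ih =>
    rw [Finset.sum_range_succ, Finset.sum_range_succ, ← ih]
    simp only [cotTerm]
    have e : (1 : ℂ) / (a - (N + 1)) = - (1 / (N + 1 - a)) := by
      rw [← neg_sub, div_neg]
    rw [e]
    push_cast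
    rw [add_comm (a : ℂ) (N + 1 : ℂ)]
    ring

/-- The Dirichlet series is used for s > 1 only; continuity on the left and dominated convergence on
the right carry it to s = 1, where it is the partial fraction expansion of the cotangent. -/
theorem hurwitzZetaOdd_one {a : ℝ} (ha0 : 0 < a) (ha1 : a < 1) :
    hurwitzZetaOdd a 1 = Real.pi * cot (Real.pi * a) / 2 := by
  set c := min a (1 - a) with hc_def
  have hc : 0 < c := lt_min ha0 (by linarith)
  have hca : c ≤ a := min_le_left _ _
  have hca' : c ≤ 1 - a := min_le_right _ _
  have hbound : ∀ (n : ℕ) (s : ℝ), 1 ≤ s → s ≤ 2 →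
      ‖1 / (n + a : ℂ) ^ (s : ℂ) - 1 / (n + 1 - a : ℂ) ^ (s : ℂ)‖ ≤
        2 * c⁻¹ ^ 3 * (1 / (n + 1 : ℝ) ^ 2) := by
    intro n s hs hs2
    have hn : (0 : ℝ) ≤ n := n.cast_nonneg
    have e1 : 1 / (n + a : ℂ) ^ (s : ℂ) = ((n + a : ℝ) ^ (-s) : ℝ) := by
      rw [Real.rpow_neg (by positivity), ofReal_inv, ofReal_cpow (by positivity)]
      push_cast
      rw [one_div]
    have e2 : 1 / (n + 1 - a : ℂ) ^ (s : ℂ) = ((n + 1 - a : ℝ) ^ (-s) : ℝ) := by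
      rw [Real.rpow_neg (by linarith), ofReal_inv, ofReal_cpow (by linarith)]
      push_cast
      rw [one_div]
    rw [e1, e2, ← ofReal_sub, norm_real, Real.norm_eq_abs]
    refine abs_rpow_neg_sub_rpow_neg_le hc (by linarith) (by linarith) ?_ ?_ ?_ hs hs2
    · nlinarith
    · nlinarith
    · rw [abs_le]; constructor <;> linarith
  have hsummable : Summable fun n : ℕ => 2 * c⁻¹ ^ 3 * (1 / (n + 1 : ℝ) ^ 2) := by
    refine Summable.mul_left _ ?_
    have := (summable_nat_add_iff 1).2 (Real.summable_one_div_nat_pow.2 one_lt_two)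
    simpa using this
  have hsum1 : Summable fun n : ℕ => (1 / (n + a : ℂ) - 1 / (n + 1 - a : ℂ)) := by
    refine Summable.of_norm_bounded hsummable fun n => ?_
    simpa using hbound n 1 le_rfl one_le_two
  have hlim : Tendsto (fun s : ℝ => ∑' n : ℕ,
      (1 / (n + a : ℂ) ^ (s : ℂ) - 1 / (n + 1 - a : ℂ) ^ (s : ℂ))) (𝓝[>] 1)
      (𝓝 (∑' n : ℕ, (1 / (n + a : ℂ) - 1 / (n + 1 - a : ℂ)))) := by
    refine tendsto_tsum_of_dominated_convergence hsummable (fun n => ?_) ?_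
    · have hne : ∀ x : ℝ, 0 < x → Tendsto (fun s : ℝ => 1 / (x : ℂ) ^ (s : ℂ)) (𝓝[>] 1)
          (𝓝 (1 / (x : ℂ))) := by
        intro x hx
        have hx0 : (x : ℂ) ≠ 0 := ofReal_ne_zero.2 hx.ne'
        have hcont : Continuous fun s : ℝ => (x : ℂ) ^ (s : ℂ) :=
          continuous_ofReal.const_cpow (Or.inl hx0)
        have := ((hcont.tendsto 1).mono_left (nhdsWithin_le_nhds (s := Set.Ioi 1)))
        simp only [ofReal_one, cpow_one] at this
        exact Tendsto.div tendsto_const_nhds this hx0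
      have hn : (0 : ℝ) ≤ n := n.cast_nonneg
      have t1 := hne (n + a) (by positivity)
      have t2 := hne (n + 1 - a) (by linarith)
      push_cast at t1 t2
      exact t1.sub t2
    · have : Set.Ioc (1 : ℝ) 2 ∈ 𝓝[>] (1 : ℝ) := Ioc_mem_nhdsGT one_lt_two
      filter_upwards [this] with s hs n
      exact hbound n s hs.1.le hs.2
  have hlim' : Tendsto (fun s : ℝ => 2 * hurwitzZetaOdd a (s : ℂ)) (𝓝[>] 1)
      (𝓝 (2 * hurwitzZetaOdd a 1)) := by
    refine Tendsto.const_mul _ ?_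
    have h1 := ((differentiable_hurwitzZetaOdd (a : UnitAddCircle)).continuous.comp
      continuous_ofReal).tendsto 1
    simp only [Function.comp_apply, ofReal_one] at h1
    exact h1.mono_left nhdsWithin_le_nhds
  have heq : (fun s : ℝ => 2 * hurwitzZetaOdd a (s : ℂ)) =ᶠ[𝓝[>] 1] fun s : ℝ => ∑' n : ℕ,
      (1 / (n + a : ℂ) ^ (s : ℂ) - 1 / (n + 1 - a : ℂ) ^ (s : ℂ)) := by
    filter_upwards [self_mem_nhdsWithin] with s hs
    have h := (hasSum_nat_hurwitzZetaOdd_of_mem_Icc (a := a) ⟨ha0.le, ha1.le⟩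
      (s := (s : ℂ)) (by simpa using hs)).mul_left 2
    rw [← h.tsum_eq]
    refine tsum_congr fun n => ?_
    ring
  have huniq := tendsto_nhds_unique (hlim'.congr' heq) hlim
  rw [(hasSum_one_div_sub_one_div ha0 ha1 hsum1).tsum_eq] at huniq
  rw [← huniq]
  ring

/-! ### Nonvanishing of ∑ χ(u) saw(u) for odd χ. -/

open ZMod

theorem sum_zmod_eq_sum_units {ℓ : ℕ} [Fact ℓ.Prime] {A : Type*} [AddCommMonoid A]
    (f : ZMod ℓ → A) (h0 : f 0 = 0) : ∑ x, f x = ∑ u : (ZMod ℓ)ˣ, f u := by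
  symm
  refine Finset.sum_of_injOn (fun u : (ZMod ℓ)ˣ => (u : ZMod ℓ)) ?_ ?_ ?_ ?_
  · exact fun a _ b _ h => Units.ext h
  · exact fun _ _ => Finset.mem_coe.2 (Finset.mem_univ _)
  · intro x _ hx
    rcases eq_or_ne x 0 with rfl | hx0
    · exact h0
    · exact absurd ⟨Units.mk0 x hx0, by simp⟩ hx
  · exact fun _ _ => rfl

theorem dirichletCharacter_zero {ℓ : ℕ} [Fact ℓ.Prime] (χ : DirichletCharacter ℂ ℓ) : χ 0 = 0 :=
  χ.map_nonunit not_isUnit_zero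

theorem ne_one_of_odd {ℓ : ℕ} {χ : DirichletCharacter ℂ ℓ} (hχ : χ.Odd) : χ ≠ 1 := by
  rintro rfl
  have h : (1 : DirichletCharacter ℂ ℓ) (-1) = -1 := hχ
  rw [MulChar.one_apply isUnit_one.neg] at h
  norm_num at h

/-- Up to a nonzero factor the sum is L(1, χ). -/
theorem sum_mul_cot_ne_zero {ℓ : ℕ} [Fact ℓ.Prime] {χ : DirichletCharacter ℂ ℓ} (hχ : χ.Odd) :
    ∑ t : ZMod ℓ, χ t * cot (Real.pi * ((t.val / ℓ : ℝ) : ℂ)) ≠ 0 := by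
  have h := DirichletCharacter.LFunction_apply_one_ne_zero (ne_one_of_odd hχ)
  rw [DirichletCharacter.LFunction, LFunction_def_odd hχ.to_fun] at h
  have h2 := right_ne_zero_of_mul h
  have heq : ∑ j : ZMod ℓ, χ j * hurwitzZetaOdd (toAddCircle j) 1 =
      (Real.pi / 2) * ∑ t : ZMod ℓ, χ t * cot (Real.pi * ((t.val / ℓ : ℝ) : ℂ)) := by
    rw [Finset.mul_sum]
    refine Finset.sum_congr rfl fun j _ => ?_
    rcases eq_or_ne j 0 with rfl | hj
    · simp [dirichletCharacter_zero]
    have hℓ : (0 : ℝ) < ℓ := by exact_mod_cast (Fact.out : ℓ.Prime).pos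
    have hv : 0 < j.val := Nat.pos_of_ne_zero (by rwa [Ne, ZMod.val_eq_zero])
    rw [toAddCircle_apply, hurwitzZetaOdd_one (by positivity)
      ((div_lt_one hℓ).2 (by exact_mod_cast j.val_lt))]
    ring
  rw [heq] at h2
  exact right_ne_zero_of_mul h2

/-- The sawtooth function on `ℤ/ℓℤ`, with value `-1/2` at `0`. -/
noncomputable def saw {ℓ : ℕ} (x : ZMod ℓ) : ℂ := x.val / ℓ - 1 / 2

theorem saw_add_one {ℓ : ℕ} [Fact ℓ.Prime] (x : ZMod ℓ) :
    saw (x + 1) = saw x + 1 / ℓ - if x = -1 then 1 else 0 := by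
  have hp := (Fact.out : ℓ.Prime)
  have hℓ : (ℓ : ℂ) ≠ 0 := by exact_mod_cast hp.ne_zero
  have : Fact (1 < ℓ) := ⟨hp.one_lt⟩
  split_ifs with hx
  · subst hx
    have h1 : ((-1 : ZMod ℓ).val : ℂ) = ℓ - 1 := by
      rw [ZMod.neg_val, if_neg one_ne_zero, ZMod.val_one, Nat.cast_sub hp.one_lt.le, Nat.cast_one]
    simp only [saw, neg_add_cancel, ZMod.val_zero, h1]
    field_simp
    push_cast
    ring
  · have h1 : (x + 1).val = x.val + 1 := by
      rw [ZMod.val_add, ZMod.val_one]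
      refine Nat.mod_eq_of_lt ?_
      have hlt := x.val_lt
      rcases Nat.lt_or_ge (x.val + 1) ℓ with h | h
      · exact h
      · refine absurd ?_ hx
        have h2 : x.val + 1 = ℓ := by omega
        have h3 : ((x.val + 1 : ℕ) : ZMod ℓ) = 0 := by rw [h2, ZMod.natCast_self]
        rw [Nat.cast_add, ZMod.natCast_zmod_val, Nat.cast_one] at h3
        exact eq_neg_of_add_eq_zero_left h3
    simp only [saw, h1]
    push_cast
    field_simp
    ring

theorem saw_neg_unit {ℓ : ℕ} [Fact ℓ.Prime] (u : (ZMod ℓ)ˣ) :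
    saw ((-u : (ZMod ℓ)ˣ) : ZMod ℓ) = -saw (u : ZMod ℓ) := by
  have hℓ : (ℓ : ℂ) ≠ 0 := by exact_mod_cast (Fact.out : ℓ.Prime).ne_zero
  simp only [saw, Units.val_neg, ZMod.neg_val, if_neg u.ne_zero,
    Nat.cast_sub (ZMod.val_lt (u : ZMod ℓ)).le]
  field_simp
  ring

/-- The shift x ↦ x + 1 gives S = ωS - 1 with ω = `stdAddChar t`, the -1 being the jump of `saw`.
The constant -1/2 disappears on summing against a nontrivial character. -/
theorem sum_saw_mul_stdAddChar {ℓ : ℕ} [Fact ℓ.Prime] {t : ZMod ℓ} (ht : t ≠ 0) :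
    ∑ x : ZMod ℓ, saw x * stdAddChar (t * x) =
      -1 / 2 - I / 2 * cot (Real.pi * ((t.val / ℓ : ℝ) : ℂ)) := by
  set S := ∑ x : ZMod ℓ, saw x * stdAddChar (t * x) with hS
  have hprim : ∑ x : ZMod ℓ, stdAddChar (t * x) = (0 : ℂ) := by
    have := AddChar.sum_eq_zero_of_ne_one (isPrimitive_stdAddChar ℓ ht)
    simpa [AddChar.mulShift_apply] using this
  have hrec : S = stdAddChar t * S - 1 := by
    conv_lhs => rw [hS, ← Equiv.sum_comp (Equiv.addRight (1 : ZMod ℓ))]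
    simp only [Equiv.coe_addRight, saw_add_one, mul_add, mul_one, AddChar.map_add_eq_mul]
    have : ∀ x : ZMod ℓ, (saw x + 1 / (ℓ : ℂ) - if x = -1 then 1 else 0) *
        (stdAddChar (t * x) * stdAddChar t) = stdAddChar t * (saw x * stdAddChar (t * x)) +
          (stdAddChar t / ℓ) * stdAddChar (t * x) -
          if x = -1 then stdAddChar (t * x) * stdAddChar t else 0 := by
      intro x
      split_ifs <;> ring
    rw [Finset.sum_congr rfl fun x _ => this x, Finset.sum_sub_distrib, Finset.sum_add_distrib,
      ← Finset.mul_sum, ← Finset.mul_sum, hprim, Finset.sum_ite_eq', if_pos (Finset.mem_univ _),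
      ← AddChar.map_add_eq_mul]
    simp
    exact Or.inl rfl
  have hℓ : (ℓ : ℂ) ≠ 0 := by exact_mod_cast (Fact.out : ℓ.Prime).ne_zero
  set φ : ℂ := Real.pi * ((t.val / ℓ : ℝ) : ℂ) with hφ
  have hω : stdAddChar t = exp (2 * I * φ) := by
    have := stdAddChar_coe (N := ℓ) (t.val : ℤ)
    rw [Int.cast_natCast, ZMod.natCast_zmod_val] at this
    rw [this, hφ]
    congr 1
    push_cast
    field_simp
  have hω1 : stdAddChar t ≠ (1 : ℂ) := by
    rw [← AddChar.map_zero_eq_one (stdAddChar (N := ℓ))]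
    exact fun h => ht (injective_stdAddChar h)
  have hcot : cot φ = (exp (2 * I * φ) + 1) / (I * (1 - exp (2 * I * φ))) :=
    Complex.cot_eq_exp_ratio φ
  have h1 : 1 - stdAddChar t ≠ (0 : ℂ) := sub_ne_zero.2 hω1.symm
  rw [hcot, ← hω]
  have hI : I ≠ 0 := I_ne_zero
  have hS' : S * (1 - stdAddChar t) = -1 := by linear_combination hrec
  rw [eq_div_of_mul_eq h1 hS']
  field_simp
  ring

/-- Computing one double sum in two ways equates the Gauss sum of χ⁻¹ times this sum with a nonzero
multiple of the cotangent sum. -/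
theorem sum_saw_mul_ne_zero {ℓ : ℕ} [Fact ℓ.Prime] {χ : DirichletCharacter ℂ ℓ} (hχ : χ.Odd) :
    ∑ u : (ZMod ℓ)ˣ, χ u * saw (u : ZMod ℓ) ≠ 0 := by
  have hodd : (χ⁻¹).Odd := by
    have h : χ (-1) = -1 := hχ
    change χ⁻¹ (-1) = -1
    rw [MulChar.inv_apply_eq_inv', h]
    norm_num
  have hne := ne_one_of_odd hodd
  have hC := sum_mul_cot_ne_zero hodd
  have hsum0 : ∑ t, χ⁻¹ t = 0 := MulChar.sum_eq_zero_of_ne_one hne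
  have key : ∑ t, χ⁻¹ t * ∑ x : ZMod ℓ, saw x * stdAddChar (t * x) =
      gaussSum χ⁻¹ stdAddChar * ∑ x : ZMod ℓ, χ x * saw x := by
    simp_rw [Finset.mul_sum]
    rw [Finset.sum_comm]
    refine Finset.sum_congr rfl fun x _ => ?_
    rcases eq_or_ne x 0 with rfl | hx
    · simp [dirichletCharacter_zero, ← Finset.sum_mul, hsum0]
    · have h := gaussSum_mulShift_eq χ⁻¹ (stdAddChar (N := ℓ)) (Units.mk0 x hx)
      rw [inv_inv, Units.val_mk0] at h
      rw [← mul_assoc, mul_comm (gaussSum _ _), ← h, gaussSum, Finset.sum_mul]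
      refine Finset.sum_congr rfl fun t _ => ?_
      rw [AddChar.mulShift_apply, mul_comm x t]
      ring
  have key2 : ∑ t, χ⁻¹ t * ∑ x : ZMod ℓ, saw x * stdAddChar (t * x) =
      - (I / 2) * ∑ t : ZMod ℓ, χ⁻¹ t * cot (Real.pi * ((t.val / ℓ : ℝ) : ℂ)) := by
    have : ∀ t : ZMod ℓ, χ⁻¹ t * ∑ x : ZMod ℓ, saw x * stdAddChar (t * x) =
        (-1 / 2) * χ⁻¹ t + - (I / 2) * (χ⁻¹ t * cot (Real.pi * ((t.val / ℓ : ℝ) : ℂ))) := by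
      intro t
      rcases eq_or_ne t 0 with rfl | ht
      · rw [dirichletCharacter_zero]
        ring
      · rw [sum_saw_mul_stdAddChar ht]
        ring
    rw [Finset.sum_congr rfl fun t _ => this t, Finset.sum_add_distrib, ← Finset.mul_sum,
      ← Finset.mul_sum, hsum0, mul_zero, zero_add]
  rw [← sum_zmod_eq_sum_units (fun x => χ x * saw x) (by simp [dirichletCharacter_zero])]
  intro h0
  rw [key2, h0, mul_zero] at key
  exact mul_ne_zero (neg_ne_zero.2 (div_ne_zero I_ne_zero two_ne_zero)) hC key

/-! ### Linear relations between dilates of the sawtooth. -/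

theorem eq_zero_of_sum_mul_char_eq_zero {ℓ : ℕ} [Fact ℓ.Prime] (f : (ZMod ℓ)ˣ → ℂ)
    (h : ∀ χ : DirichletCharacter ℂ ℓ, ∑ a, f a * χ a = 0) (a : (ZMod ℓ)ˣ) : f a = 0 := by
  have h1 : ∑ χ : DirichletCharacter ℂ ℓ, χ (a : ZMod ℓ)⁻¹ * ∑ b, f b * χ b = 0 :=
    Finset.sum_eq_zero fun χ _ => by rw [h, mul_zero]
  simp_rw [Finset.mul_sum] at h1
  rw [Finset.sum_comm] at h1
  have h2 : ∀ b : (ZMod ℓ)ˣ, ∑ χ : DirichletCharacter ℂ ℓ, χ (a : ZMod ℓ)⁻¹ * (f b * χ b) =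
      if a = b then f b * ℓ.totient else 0 := by
    intro b
    have := DirichletCharacter.sum_char_inv_mul_char_eq ℂ a.isUnit (b : ZMod ℓ)
    simp_rw [mul_left_comm _ (f b)]
    rw [← Finset.mul_sum, this]
    simp only [Units.val_inj, mul_ite, mul_zero]
  rw [Finset.sum_congr rfl fun b _ => h2 b, Finset.sum_ite_eq, if_pos (Finset.mem_univ _)] at h1
  refine (mul_eq_zero.1 h1).resolve_right ?_
  exact_mod_cast (Nat.totient_pos.2 (Fact.out : ℓ.Prime).pos).ne'

theorem sum_saw_mul_left {ℓ : ℕ} [Fact ℓ.Prime] (χ : DirichletCharacter ℂ ℓ) (t : (ZMod ℓ)ˣ) :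
    ∑ j : (ZMod ℓ)ˣ, χ j * saw ((t * j : (ZMod ℓ)ˣ) : ZMod ℓ) =
      χ⁻¹ t * ∑ u : (ZMod ℓ)ˣ, χ u * saw (u : ZMod ℓ) := by
  rw [← Equiv.sum_comp (Equiv.mulLeft t) (fun u : (ZMod ℓ)ˣ => χ u * saw (u : ZMod ℓ)),
    Finset.mul_sum]
  refine Finset.sum_congr rfl fun j _ => ?_
  have hinv : χ⁻¹ t * χ t = 1 := by
    rw [← MulChar.mul_apply, inv_mul_cancel, MulChar.one_apply t.isUnit]
  simp only [Equiv.coe_mulLeft, Units.val_mul, map_mul]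
  linear_combination (- χ j * saw ((t : ZMod ℓ) * (j : ZMod ℓ))) * hinv

/-- Summing the relations against an odd χ factors out the nonzero sum ∑ χ(u) saw(u), so every odd
Fourier coefficient of g vanishes. -/
theorem even_of_sum_mul_saw_eq_zero {ℓ : ℕ} [Fact ℓ.Prime] (g : (ZMod ℓ)ˣ → ℂ)
    (h : ∀ j : (ZMod ℓ)ˣ, ∑ a, g a * saw ((a * j : (ZMod ℓ)ˣ) : ZMod ℓ) = 0) (a : (ZMod ℓ)ˣ) :
    g a = g (-a) := by
  have hodd : ∀ χ : DirichletCharacter ℂ ℓ, χ.Odd → ∑ a, g a * χ⁻¹ a = 0 := by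
    intro χ hχ
    have h1 : ∑ j : (ZMod ℓ)ˣ, χ j * ∑ a, g a * saw ((a * j : (ZMod ℓ)ˣ) : ZMod ℓ) = 0 :=
      Finset.sum_eq_zero fun j _ => by rw [h, mul_zero]
    simp_rw [Finset.mul_sum] at h1
    rw [Finset.sum_comm] at h1
    have h2 : ∀ a : (ZMod ℓ)ˣ, ∑ j : (ZMod ℓ)ˣ, χ j * (g a * saw ((a * j : (ZMod ℓ)ˣ) : ZMod ℓ)) =
        g a * χ⁻¹ a * ∑ u : (ZMod ℓ)ˣ, χ u * saw (u : ZMod ℓ) := by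
      intro a
      simp_rw [mul_left_comm _ (g a)]
      rw [← Finset.mul_sum, sum_saw_mul_left, mul_assoc]
    rw [Finset.sum_congr rfl fun a _ => h2 a, ← Finset.sum_mul] at h1
    exact (mul_eq_zero.1 h1).resolve_right (sum_saw_mul_ne_zero hχ)
  refine sub_eq_zero.1 (eq_zero_of_sum_mul_char_eq_zero (fun a => g a - g (-a)) (fun χ => ?_) a)
  have hneg : ∑ a : (ZMod ℓ)ˣ, g (-a) * χ a = χ (-1) * ∑ a : (ZMod ℓ)ˣ, g a * χ a := by
    rw [← Equiv.sum_comp (Equiv.neg _), Finset.mul_sum]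
    refine Finset.sum_congr rfl fun j _ => ?_
    simp only [Equiv.neg_apply, neg_neg, Units.val_neg]
    rw [← neg_one_mul (j : ZMod ℓ), map_mul]
    ring
  simp only [sub_mul, Finset.sum_sub_distrib]
  rw [hneg]
  rcases χ.even_or_odd with hχ | hχ
  · rw [show χ (-1) = 1 from hχ, one_mul, sub_self]
  · have h3 := hodd χ⁻¹ (by
      change χ⁻¹ (-1) = -1
      rw [MulChar.inv_apply_eq_inv', show χ (-1) = -1 from hχ]
      norm_num)
    rw [inv_inv] at h3
    rw [h3, mul_zero, sub_zero]

/-! ### Structure of `M` and triviality of `W`. -/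

/-- The representatives of j, kj and -(k+1)j add up to ℓ or 2ℓ, and to ℓ exactly when j lies in `M`.
-/
theorem E_sub_half {k ℓ : ℕ} [Fact ℓ.Prime] {κ μ : (ZMod ℓ)ˣ} (hκ : (κ : ZMod ℓ) = k)
    (hμ : (μ : ZMod ℓ) = k + 1) (j : (ZMod ℓ)ˣ) :
    (E k ℓ j : ℂ) - 1 / 2 = saw ((1 * j : (ZMod ℓ)ˣ) : ZMod ℓ) +
      saw ((κ * j : (ZMod ℓ)ˣ) : ZMod ℓ) + saw ((-μ * j : (ZMod ℓ)ˣ) : ZMod ℓ) := by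
  have hℓ : (ℓ : ℂ) ≠ 0 := by exact_mod_cast (Fact.out : ℓ.Prime).ne_zero
  have hpos : ∀ u : (ZMod ℓ)ˣ, 0 < (u : ZMod ℓ).val := fun u =>
    Nat.pos_of_ne_zero (by rw [Ne, ZMod.val_eq_zero]; exact u.ne_zero)
  have ha := hpos (1 * j)
  have hb := hpos (κ * j)
  have hc := hpos (-μ * j)
  have ha' := ((1 * j : (ZMod ℓ)ˣ) : ZMod ℓ).val_lt
  have hb' := ((κ * j : (ZMod ℓ)ˣ) : ZMod ℓ).val_lt
  have hc' := ((-μ * j : (ZMod ℓ)ˣ) : ZMod ℓ).val_lt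
  have hdvd : ℓ ∣ ((1 * j : (ZMod ℓ)ˣ) : ZMod ℓ).val + ((κ * j : (ZMod ℓ)ˣ) : ZMod ℓ).val +
      ((-μ * j : (ZMod ℓ)ˣ) : ZMod ℓ).val := by
    rw [← ZMod.natCast_eq_zero_iff]
    push_cast
    simp only [ZMod.natCast_val, ZMod.cast_id]
    rw [hκ, hμ]
    ring
  have hM : j ∈ M k ℓ ↔ ((κ * j : (ZMod ℓ)ˣ) : ZMod ℓ).val +
      ((1 * j : (ZMod ℓ)ˣ) : ZMod ℓ).val < ℓ := by
    rw [M, Set.mem_ofPred, Units.val_mul, hκ, one_mul]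
  generalize ((1 * j : (ZMod ℓ)ˣ) : ZMod ℓ) = a at *
  generalize ((κ * j : (ZMod ℓ)ˣ) : ZMod ℓ) = b at *
  generalize ((-μ * j : (ZMod ℓ)ˣ) : ZMod ℓ) = c at *
  obtain ⟨q, hq⟩ := hdvd
  have hq3 : q < 3 := by
    by_contra! h
    have := Nat.mul_le_mul_left ℓ h
    omega
  have hq0 : q ≠ 0 := by rintro rfl; omega
  have hsum : (a.val : ℂ) + b.val + c.val = ℓ * q := by exact_mod_cast hq
  have hsaw : saw a + saw b + saw c = q - 3 / 2 := by
    simp only [saw]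
    field_simp
    linear_combination 2 * hsum
  rw [hsaw]
  have hcases : q = 1 ∨ q = 2 := by omega
  rcases hcases with rfl | rfl
  · have : j ∈ M k ℓ := hM.2 (by omega)
    simp [E, this]
    norm_num
  · have : j ∉ M k ℓ := fun h => by have := hM.1 h; omega
    simp [E, this]
    norm_num

theorem neg_mem_M_iff {k ℓ : ℕ} [Fact ℓ.Prime] {κ μ : (ZMod ℓ)ˣ} (hκ : (κ : ZMod ℓ) = k)
    (hμ : (μ : ZMod ℓ) = k + 1) (j : (ZMod ℓ)ˣ) : -j ∈ M k ℓ ↔ j ∉ M k ℓ := by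
  have h1 := E_sub_half hκ hμ j
  have h2 := E_sub_half hκ hμ (-j)
  simp only [mul_neg, saw_neg_unit] at h2
  have h3 : (E k ℓ (-j) : ℂ) + E k ℓ j = 1 := by linear_combination h1 + h2
  by_cases hj : j ∈ M k ℓ <;> by_cases hj' : -j ∈ M k ℓ <;>
    simp [E, hj, hj'] at h3 ⊢

theorem W_eq_bot {k ℓ : ℕ} [Fact ℓ.Prime] {κ μ : (ZMod ℓ)ˣ} (hκ : (κ : ZMod ℓ) = k)
    (hμ : (μ : ZMod ℓ) = k + 1) (h2 : (2 : ZMod ℓ) ≠ 0) (hk1 : (k : ZMod ℓ) ≠ 1)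
    (hk2 : (k : ZMod ℓ) + 2 ≠ 0) (hk3 : 2 * (k : ZMod ℓ) + 1 ≠ 0)
    (hk4 : (k : ZMod ℓ) ^ 2 + k + 1 ≠ 0) : W k ℓ = ⊥ := by
  classical
  have hκ0 : (k : ZMod ℓ) ≠ 0 := hκ ▸ κ.ne_zero
  have hμ0 : (k : ZMod ℓ) + 1 ≠ 0 := hμ ▸ μ.ne_zero
  set T : Finset (ZMod ℓ)ˣ := {1, κ, -μ} with hT
  have hmem : ∀ a : (ZMod ℓ)ˣ, a ∈ T ↔ (a : ZMod ℓ) = 1 ∨ (a : ZMod ℓ) = k ∨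
      (a : ZMod ℓ) = -(k + 1) := by
    intro a
    simp only [hT, Finset.mem_insert, Finset.mem_singleton, ← Units.val_inj, Units.val_one, hκ,
      Units.val_neg, hμ]
  have hdis : ∀ a ∈ T, -a ∉ T := by
    intro a ha hna
    rw [hmem] at ha hna
    rw [Units.val_neg] at hna
    have hk0 : (a : ZMod ℓ) ≠ 0 := a.ne_zero
    rcases ha with ha | ha | ha <;> rw [ha] at hna <;> rcases hna with h | h | h
    · exact h2 (by linear_combination -h)
    · exact hμ0 (by linear_combination -h)
    · exact hκ0 (by linear_combination h)
    · exact hμ0 (by linear_combination -h)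
    · exact mul_ne_zero h2 hκ0 (by linear_combination -h)
    · exact one_ne_zero (by linear_combination h : (1 : ZMod ℓ) = 0)
    · exact hκ0 (by linear_combination h)
    · exact one_ne_zero (by linear_combination h : (1 : ZMod ℓ) = 0)
    · exact mul_ne_zero h2 hμ0 (by linear_combination h)
  have hsumT : ∀ j : (ZMod ℓ)ˣ,
      (E k ℓ j : ℂ) - 1 / 2 = ∑ t ∈ T, saw ((t * j : (ZMod ℓ)ˣ) : ZMod ℓ) := by
    intro j
    have n1 : (1 : (ZMod ℓ)ˣ) ∉ ({κ, -μ} : Finset (ZMod ℓ)ˣ) := by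
      simp only [Finset.mem_insert, Finset.mem_singleton, ← Units.val_inj, Units.val_one, hκ,
        Units.val_neg, hμ, not_or]
      exact ⟨hk1.symm, fun h => hk2 (by linear_combination h)⟩
    have n2 : κ ∉ ({-μ} : Finset (ZMod ℓ)ˣ) := by
      simp only [Finset.mem_singleton, ← Units.val_inj, hκ, Units.val_neg, hμ]
      exact fun h => hk3 (by linear_combination h)
    rw [E_sub_half hκ hμ, hT, Finset.sum_insert n1, Finset.sum_insert n2, Finset.sum_singleton,
      add_assoc]
  rw [eq_bot_iff]
  intro w hw
  have hstable : ∀ a ∈ T, w⁻¹ * a ∈ T := by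
    intro a ha
    -- Here g is the indicator of T minus that of wT. As T and -T are disjoint, g(-a) ≤ 0 for a in
    -- T, so evenness forces a ∈ wT.
    have h := even_of_sum_mul_saw_eq_zero
      (fun a : (ZMod ℓ)ˣ => (if a ∈ T then (1 : ℂ) else 0) - if w⁻¹ * a ∈ T then 1 else 0) ?_ a
    · simp only [if_pos ha, if_neg (hdis a ha), mul_neg] at h
      by_contra hna
      rw [if_neg hna] at h
      split_ifs at h <;> norm_num at h
    · intro j
      simp only [sub_mul, ite_mul, one_mul, zero_mul, Finset.sum_sub_distrib]
      rw [← Equiv.sum_comp (Equiv.mulLeft w) (fun a : (ZMod ℓ)ˣ =>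
        if w⁻¹ * a ∈ T then saw ((a * j : (ZMod ℓ)ˣ) : ZMod ℓ) else 0)]
      simp only [Equiv.coe_mulLeft, inv_mul_cancel_left, Finset.sum_ite_mem, Finset.univ_inter]
      have e : ∑ t ∈ T, saw ((w * t * j : (ZMod ℓ)ˣ) : ZMod ℓ) =
          ∑ t ∈ T, saw ((t * (j * w) : (ZMod ℓ)ˣ) : ZMod ℓ) :=
        Finset.sum_congr rfl fun t _ => by rw [mul_comm w t, mul_assoc, mul_comm w j]
      rw [e, ← hsumT, ← hsumT, E_mul hw, sub_self]
  -- Both w⁻¹ and its square lie in T; unless w = 1, each combination contradicts a hypothesis on k.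
  have h1 : w⁻¹ ∈ T := by simpa using hstable 1 (by simp [hT])
  have hsq : w⁻¹ * w⁻¹ ∈ T := hstable _ h1
  rw [Subgroup.mem_bot, ← inv_eq_one, ← Units.val_inj, Units.val_one]
  rw [hmem] at h1 hsq
  rw [Units.val_mul] at hsq
  rcases h1 with h | h | h
  · exact h
  · exfalso
    rw [h] at hsq
    rcases hsq with h' | h' | h'
    · exact mul_ne_zero (sub_ne_zero.2 hk1) hμ0 (by linear_combination h')
    · exact mul_ne_zero hκ0 (sub_ne_zero.2 hk1) (by linear_combination h')
    · exact hk4 (by linear_combination h')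
  · exfalso
    rw [h] at hsq
    rcases hsq with h' | h' | h'
    · exact mul_ne_zero hκ0 hk2 (by linear_combination h')
    · exact hk4 (by linear_combination h')
    · exact mul_ne_zero hμ0 hk2 (by linear_combination h')

/-! ### A kernel vector of the Demjanenko matrix. -/

open Classical in
theorem det_D_eq_zero {k ℓ : ℕ} [Fact ℓ.Prime] {κ μ : (ZMod ℓ)ˣ} (hκ : (κ : ZMod ℓ) = k)
    (hμ : (μ : ZMod ℓ) = k + 1) (hW : W k ℓ = ⊥) {χ : DirichletCharacter ℂ ℓ} (hχ : χ.Odd)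
    (hrel : 1 + χ⁻¹ κ - χ⁻¹ μ = 0) : (D k ℓ).det = 0 := by
  have hinj : Function.Injective (fun j : (ZMod ℓ)ˣ => (j : (ZMod ℓ)ˣ ⧸ W k ℓ)) := by
    intro a b hab
    have h := QuotientGroup.eq.1 hab
    rw [hW, Subgroup.mem_bot] at h
    exact inv_mul_eq_one.1 h
  let e : M k ℓ ≃ MQuot k ℓ := Equiv.Set.image _ _ hinj
  have hχneg : ∀ x : ZMod ℓ, χ (-x) = -χ x := hχ.to_fun
  have htot : ∑ b : (ZMod ℓ)ˣ, χ b * ((E k ℓ b : ℂ) - 1 / 2) = 0 := by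
    have hodd : χ⁻¹ ((-μ : (ZMod ℓ)ˣ) : ZMod ℓ) = -χ⁻¹ μ := by
      rw [Units.val_neg, MulChar.inv_apply_eq_inv', hχneg, inv_neg, MulChar.inv_apply_eq_inv']
    simp only [E_sub_half hκ hμ, mul_add, Finset.sum_add_distrib]
    rw [sum_saw_mul_left, sum_saw_mul_left, sum_saw_mul_left, hodd, Units.val_one, map_one,
      ← add_mul, ← add_mul, ← sub_eq_add_neg, hrel, zero_mul]
  have hker : ∀ c : (ZMod ℓ)ˣ,
      ∑ a : M k ℓ, ((E k ℓ (-c⁻¹ * a) : ℂ) - 1 / 2) * χ (a : (ZMod ℓ)ˣ) = 0 := by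
    intro c
    set F : (ZMod ℓ)ˣ → ℂ := fun a => ((E k ℓ (-c⁻¹ * a) : ℂ) - 1 / 2) * χ a with hF
    have hFeven : ∀ a, F (-a) = F a := by
      intro a
      have h1 := E_sub_half hκ hμ (-c⁻¹ * a)
      have h2 := E_sub_half hκ hμ (-(-c⁻¹ * a))
      simp only [mul_neg, saw_neg_unit] at h2
      simp only [hF, mul_neg, Units.val_neg, hχneg]
      linear_combination (-χ a) * h2 - χ a * h1
    have hall : ∑ a, F a = 0 := by
      rw [← Equiv.sum_comp (Equiv.mulLeft (-c)) F]
      have : ∀ b : (ZMod ℓ)ˣ, F (Equiv.mulLeft (-c) b) =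
          χ ((-c : (ZMod ℓ)ˣ) : ZMod ℓ) * (χ b * ((E k ℓ b : ℂ) - 1 / 2)) := by
        intro b
        simp only [hF, Equiv.coe_mulLeft]
        rw [← mul_assoc, neg_mul_neg, inv_mul_cancel, one_mul, Units.val_mul, map_mul]
        ring
      rw [Finset.sum_congr rfl fun b _ => this b, ← Finset.mul_sum, htot, mul_zero]
    -- F is even, as a product of two odd functions, and -1 exchanges `M` with its complement, so
    -- the sum over `M` is half the full sum.
    have hsplit := Finset.sum_add_sum_compl (M k ℓ).toFinset F
    have hcompl : ∑ a ∈ (M k ℓ).toFinsetᶜ, F a = ∑ a ∈ (M k ℓ).toFinset, F a := by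
      refine Finset.sum_nbij' (fun a => -a) (fun a => -a) ?_ ?_ ?_ ?_ ?_
      · intro a ha
        simpa [neg_mem_M_iff hκ hμ] using ha
      · intro a ha
        simpa [neg_mem_M_iff hκ hμ] using ha
      · exact fun a _ => neg_neg a
      · exact fun a _ => neg_neg a
      · exact fun a _ => (hFeven a).symm
    rw [hcompl, hall] at hsplit
    have hz : ∑ a ∈ (M k ℓ).toFinset, F a = 0 := by
      linear_combination (1 / 2 : ℂ) * hsplit
    rw [Finset.sum_subtype (M k ℓ).toFinset (fun x => Set.mem_toFinset) F] at hz
    exact hz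
  have hne : (M k ℓ).Nonempty := by
    by_cases h : (1 : (ZMod ℓ)ˣ) ∈ M k ℓ
    · exact ⟨1, h⟩
    · exact ⟨-1, (neg_mem_M_iff hκ hμ 1).2 h⟩
  obtain ⟨a₀, ha₀⟩ := hne
  rw [← Matrix.det_submatrix_equiv_self e]
  have hdet : (((D k ℓ).submatrix e e).map (algebraMap ℚ ℂ)).det = 0 := by
    refine Matrix.exists_mulVec_eq_zero_iff.1 ⟨fun a => χ (a : (ZMod ℓ)ˣ), ?_, ?_⟩
    · intro h
      exact (a₀.isUnit.map χ).ne_zero (congrFun h ⟨a₀, ha₀⟩)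
    · funext c
      rw [Pi.zero_apply, ← hker c]
      refine Finset.sum_congr rfl fun a _ => ?_
      have h := D_apply k ℓ c.2 a.2
      change (algebraMap ℚ ℂ) (D k ℓ ⟨_, c, c.2, rfl⟩ ⟨_, a, a.2, rfl⟩) * χ (a : (ZMod ℓ)ˣ) = _
      rw [h]
      simp
  have hmap := RingHom.map_det (algebraMap ℚ ℂ) ((D k ℓ).submatrix e e)
  rw [RingHom.mapMatrix_apply, hdet] at hmap
  exact (map_eq_zero (algebraMap ℚ ℂ)).1 hmap

/-! ### Counting y with prescribed χ(y) and χ(1-y). -/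

theorem norm_jacobiSum_le {ℓ : ℕ} [Fact ℓ.Prime] (χ ψ : MulChar (ZMod ℓ) ℂ)
    (h : ¬(χ = 1 ∧ ψ = 1)) : ‖jacobiSum χ ψ‖ ≤ √ℓ := by
  have hℓ1 : 1 ≤ √(ℓ : ℝ) := Real.one_le_sqrt.2 (by exact_mod_cast (Fact.out : ℓ.Prime).one_lt.le)
  by_cases hχ : χ = 1
  · have hψ : ψ ≠ 1 := fun hψ => h ⟨hχ, hψ⟩
    rw [hχ, jacobiSum_one_nontrivial hψ, norm_neg, norm_one]
    exact hℓ1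
  by_cases hψ : ψ = 1
  · rw [hψ, jacobiSum_comm, jacobiSum_one_nontrivial hχ, norm_neg, norm_one]
    exact hℓ1
  by_cases hχψ : χ * ψ = 1
  · rw [← inv_eq_of_mul_eq_one_right hχψ, jacobiSum_nontrivial_inv hχ, norm_neg]
    exact (DirichletCharacter.norm_le_one χ _).trans hℓ1
  have hchar : ringChar ℂ ≠ ringChar (ZMod ℓ) := by
    rw [ringChar.eq_zero, ZMod.ringChar_zmod_n]
    exact (Fact.out : ℓ.Prime).ne_zero.symm
  have hmul := jacobiSum_mul_jacobiSum_inv hchar hχ hψ hχψ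
  have hconj : jacobiSum χ⁻¹ ψ⁻¹ = star (jacobiSum χ ψ) := by
    simp only [jacobiSum, star_sum, star_mul', MulChar.star_apply']
  rw [hconj, ZMod.card] at hmul
  have hn : ‖jacobiSum χ ψ‖ * ‖jacobiSum χ ψ‖ = ℓ := by
    have := congrArg norm hmul
    rwa [norm_mul, norm_star, Complex.norm_natCast] at this
  exact Real.le_sqrt_of_sq_le (by rw [sq, hn])

theorem sum_pow_mul_inv_pow {ℓ n : ℕ} [Fact ℓ.Prime] {χ : MulChar (ZMod ℓ) ℂ} (hχ : χ ^ n = 1)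
    {p : ℂ} (hp0 : p ≠ 0) (hp : p ^ n = 1) (y : ZMod ℓ) :
    ∑ i ∈ Finset.range n, (χ ^ i) y * p⁻¹ ^ i = if χ y = p then (n : ℂ) else 0 := by
  rcases eq_or_ne y 0 with rfl | hy
  · rw [χ.map_zero, if_neg hp0.symm]
    exact Finset.sum_eq_zero fun i _ => by rw [MulChar.map_zero, zero_mul]
  have hpow : ∀ i, (χ ^ i) y = χ y ^ i := fun i => by
    have := MulChar.pow_apply_coe χ i (Units.mk0 y hy)
    simpa using this
  simp only [hpow, ← mul_pow]
  split_ifs with h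
  · simp [h, hp0]
  · have hz : (χ y * p⁻¹) ^ n = 1 := by
      rw [mul_pow, inv_pow, hp, ← hpow, hχ, MulChar.one_apply hy.isUnit]
      norm_num
    have hz1 : χ y * p⁻¹ ≠ 1 := fun h1 => h (by
      rwa [← div_eq_mul_inv, div_eq_one_iff_eq hp0] at h1)
    rw [geom_sum_eq hz1, hz, sub_self, zero_div]

-- Orthogonality over the powers of χ expresses n² times the count through n² Jacobi sums: J(1, 1) =
-- ℓ - 2 is the main term, and each of the others is at most √ℓ.
open Classical in
theorem le_sq_mul_card_filter {ℓ n : ℕ} [Fact ℓ.Prime] {χ : MulChar (ZMod ℓ) ℂ} (hn : 0 < n)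
    (hχ : orderOf χ = n) {p q : ℂ} (hp : p ^ n = 1) (hq : q ^ n = 1) :
    (ℓ : ℝ) - 2 - (n ^ 2 - 1) * √ℓ ≤
      n ^ 2 * (Finset.univ.filter fun y : ZMod ℓ => χ y = p ∧ χ (1 - y) = q).card := by
  have hχn : χ ^ n = 1 := hχ ▸ pow_orderOf_eq_one χ
  have hp0 : p ≠ 0 := by rintro rfl; simp [hn.ne'] at hp
  have hq0 : q ≠ 0 := by rintro rfl; simp [hn.ne'] at hq
  have hpn : ‖p‖ = 1 := Complex.norm_eq_one_of_pow_eq_one hp hn.ne'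
  have hqn : ‖q‖ = 1 := Complex.norm_eq_one_of_pow_eq_one hq hn.ne'
  set S := Finset.univ.filter fun y : ZMod ℓ => χ y = p ∧ χ (1 - y) = q with hS
  set R := Finset.range n ×ˢ Finset.range n with hR
  have hcount : ((n ^ 2 * S.card : ℝ) : ℂ) =
      ∑ x ∈ R, p⁻¹ ^ x.1 * q⁻¹ ^ x.2 * jacobiSum (χ ^ x.1) (χ ^ x.2) := by
    have h1 : ∀ y : ZMod ℓ, (if χ y = p ∧ χ (1 - y) = q then (n : ℂ) ^ 2 else 0) =
        ∑ x ∈ R, ((χ ^ x.1) y * p⁻¹ ^ x.1) * ((χ ^ x.2) (1 - y) * q⁻¹ ^ x.2) := by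
      intro y
      rw [hR, Finset.sum_product]
      dsimp only
      rw [← Finset.sum_mul_sum, sum_pow_mul_inv_pow hχn hp0 hp,
        sum_pow_mul_inv_pow hχn hq0 hq]
      by_cases hy1 : χ y = p <;> by_cases hy2 : χ (1 - y) = q <;> simp [hy1, hy2, sq]
    have h2 : ((n ^ 2 * S.card : ℝ) : ℂ) =
        ∑ y : ZMod ℓ, if χ y = p ∧ χ (1 - y) = q then (n : ℂ) ^ 2 else 0 := by
      rw [← Finset.sum_filter, Finset.sum_const, nsmul_eq_mul]
      push_cast
      ring
    rw [h2, Finset.sum_congr rfl fun y _ => h1 y, Finset.sum_comm]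
    refine Finset.sum_congr rfl fun x _ => ?_
    rw [jacobiSum, Finset.mul_sum]
    exact Finset.sum_congr rfl fun y _ => by ring
  have h0 : ((0, 0) : ℕ × ℕ) ∈ R := by simp [hR, hn]
  rw [← Finset.add_sum_erase R _ h0] at hcount
  simp only [pow_zero, mul_one, one_mul, jacobiSum_one_one, ZMod.card] at hcount
  have hbound : ‖∑ x ∈ R.erase (0, 0), p⁻¹ ^ x.1 * q⁻¹ ^ x.2 * jacobiSum (χ ^ x.1) (χ ^ x.2)‖ ≤
      (n ^ 2 - 1) * √ℓ := by
    refine (norm_sum_le_of_le (R.erase (0, 0)) (f := fun x : ℕ × ℕ =>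
      p⁻¹ ^ x.1 * q⁻¹ ^ x.2 * jacobiSum (χ ^ x.1) (χ ^ x.2)) (n := fun _ => √ℓ) ?_).trans ?_
    · intro x hx
      obtain ⟨hx0, hxR⟩ := Finset.mem_erase.1 hx
      rw [hR, Finset.mem_product, Finset.mem_range, Finset.mem_range] at hxR
      simp only [norm_mul, norm_pow, norm_inv, hpn, hqn, inv_one, one_pow, one_mul]
      refine norm_jacobiSum_le _ _ fun ⟨e1, e2⟩ => hx0 ?_
      have hz : ∀ i, i < n → χ ^ i = 1 → i = 0 := fun i hi hi1 =>
        Nat.eq_zero_of_dvd_of_lt (hχ ▸ orderOf_dvd_of_pow_eq_one hi1) hi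
      exact Prod.ext (hz _ hxR.1 e1) (hz _ hxR.2 e2)
    · rw [Finset.sum_const, nsmul_eq_mul, Finset.card_erase_of_mem h0, hR, Finset.card_product,
        Finset.card_range, Nat.cast_sub (Nat.mul_pos hn hn), Nat.cast_mul, Nat.cast_one, sq]
  set Z := ∑ x ∈ R.erase (0, 0), p⁻¹ ^ x.1 * q⁻¹ ^ x.2 * jacobiSum (χ ^ x.1) (χ ^ x.2)
  have hre := congrArg Complex.re hcount
  rw [Complex.ofReal_re, Complex.add_re, Complex.sub_re, Complex.natCast_re] at hre
  have h3 := (Complex.abs_re_le_norm Z).trans hbound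
  have h4 := neg_le_of_abs_le h3
  have h5 : (2 : ℂ).re = 2 := rfl
  linarith

/-! ### From a character and a value of y to an element of `K`. -/

/-- Since u^((ℓ-1)/2) = ±1, an even character has order dividing (ℓ-1)/2. -/
theorem odd_of_orderOf {ℓ n : ℕ} [Fact ℓ.Prime] {χ : DirichletCharacter ℂ ℓ}
    (hχ : orderOf χ = n) (hn : ¬n ∣ (ℓ - 1) / 2) (hℓ : ℓ ≠ 2) : χ.Odd := by
  refine χ.even_or_odd.resolve_left fun heven => hn ?_
  rw [← hχ]
  refine orderOf_dvd_of_pow_eq_one (MulChar.ext fun u => ?_)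
  have hodd := (Fact.out : ℓ.Prime).odd_of_ne_two hℓ
  have hhalf : (ℓ - 1) / 2 = ℓ / 2 := by
    obtain ⟨r, hr⟩ := hodd
    omega
  rw [MulChar.pow_apply_coe, MulChar.one_apply_coe, ← map_pow, hhalf]
  rcases ZMod.pow_div_two_eq_neg_one_or_one ℓ u.ne_zero with h | h
  · rw [h, map_one]
  · rw [h]
    exact heven

theorem exists_mem_sq_sub_add_one_ne_zero {F : Type*} [Field F] [DecidableEq F] {S : Finset F}
    (hS : 2 < S.card) : ∃ y ∈ S, y ^ 2 - y + 1 ≠ 0 := by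
  by_contra! h
  obtain ⟨z, hz⟩ := Finset.card_pos.1 (by omega : 0 < S.card)
  have hsub : S ⊆ {z, 1 - z} := by
    intro y hy
    have : (y - z) * (y - (1 - z)) = 0 := by linear_combination h y hy - h z hz
    rw [Finset.mem_insert, Finset.mem_singleton]
    exact (mul_eq_zero.1 this).imp sub_eq_zero.1 sub_eq_zero.1
  have := (Finset.card_le_card hsub).trans Finset.card_le_two
  omega

theorem exists_sixth_root : ∃ p : ℂ, p ^ 2 - p + 1 = 0 := by
  refine ⟨1 / 2 + √3 / 2 * Complex.I, ?_⟩
  have h3 : ((√3 : ℝ) : ℂ) ^ 2 = 3 := by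
    rw [← Complex.ofReal_pow, Real.sq_sqrt (by norm_num)]
    norm_num
  linear_combination (1 / 4 * Complex.I ^ 2) * h3 + (3 / 4 : ℂ) * Complex.I_sq

theorem mem_K_of_character {ℓ : ℕ} [Fact ℓ.Prime] (hℓ : ℓ ≠ 2) {χ : DirichletCharacter ℂ ℓ}
    (hχ : χ.Odd) {p : ℂ} (hp : p ^ 2 - p + 1 = 0) {y : ZMod ℓ} (hy : χ y = p)
    (hy' : χ (1 - y) = p⁻¹) (hy3 : y ^ 2 - y + 1 ≠ 0) : (y - 1).val ∈ K ℓ := by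
  have hp0 : p ≠ 0 := by rintro rfl; norm_num at hp
  have hχneg : ∀ x : ZMod ℓ, χ (-x) = -χ x := hχ.to_fun
  have hκχ : χ (y - 1) = -p⁻¹ := by rw [← hy', ← hχneg, neg_sub]
  have hy0 : y ≠ 0 := by
    rintro rfl
    exact hp0 (by rw [← hy, dirichletCharacter_zero])
  have hy1 : y - 1 ≠ 0 := by
    intro h
    rw [h, dirichletCharacter_zero] at hκχ
    exact hp0 (inv_eq_zero.1 (neg_eq_zero.1 hκχ.symm))
  have hcast : (((y - 1).val : ℕ) : ZMod ℓ) = y - 1 := ZMod.natCast_zmod_val _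
  have hp1 : p ≠ -1 := by rintro rfl; norm_num at hp
  have hpp : p ^ 2 ≠ 1 := by
    intro h
    have h2 : p = 2 := by linear_combination h - hp
    rw [h2] at h
    norm_num at h
  have h2 : (2 : ZMod ℓ) ≠ 0 := by
    intro h
    have h' : ((2 : ℕ) : ZMod ℓ) = 0 := by exact_mod_cast h
    rw [ZMod.natCast_eq_zero_iff, Nat.prime_dvd_prime_iff_eq Fact.out Nat.prime_two] at h'
    exact hℓ h'
  have hκ : ((Units.mk0 (y - 1) hy1 : (ZMod ℓ)ˣ) : ZMod ℓ) = ((y - 1).val : ℕ) := by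
    rw [hcast, Units.val_mk0]
  have hμ : ((Units.mk0 y hy0 : (ZMod ℓ)ˣ) : ZMod ℓ) = ((y - 1).val : ℕ) + 1 := by
    rw [hcast, Units.val_mk0, sub_add_cancel]
  have hW : W (y - 1).val ℓ = ⊥ := by
    -- The cases k = 1, k = -2 and 2k + 1 = 0 would give p = -1, p = -1 and p² = 1; the last
    -- condition is `hy3`, as k² + k + 1 = y² - y + 1.
    refine W_eq_bot hκ hμ h2 ?_ ?_ ?_ ?_ <;> rw [hcast]
    · intro h
      rw [h, map_one] at hκχ
      refine hp1 ?_
      rw [← inv_inj, inv_neg, inv_one]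
      linear_combination hκχ
    · intro h
      have h' : y = -1 := by linear_combination h
      rw [h', hχneg, map_one] at hy
      exact hp1 hy.symm
    · intro h
      have h' : 1 - y = y := by linear_combination -h
      rw [h', hy] at hy'
      refine hpp ?_
      rw [sq]
      nth_rewrite 2 [hy']
      exact mul_inv_cancel₀ hp0
    · intro h
      exact hy3 (by linear_combination h)
  refine ⟨Nat.pos_of_ne_zero (by rwa [Ne, ZMod.val_eq_zero]), ?_, ?_⟩
  · have hlt := (y - 1).val_lt
    have hne : (y - 1).val + 1 ≠ ℓ := by
      intro h
      have h' : (((y - 1).val + 1 : ℕ) : ZMod ℓ) = 0 := by rw [h, ZMod.natCast_self]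
      rw [Nat.cast_add, hcast, Nat.cast_one, sub_add_cancel] at h'
      exact hy0 h'
    omega
  · refine det_D_eq_zero hκ hμ hW hχ ?_
    rw [Units.val_mk0, Units.val_mk0, MulChar.inv_apply_eq_inv', MulChar.inv_apply_eq_inv', hκχ,
      hy, inv_neg, inv_inv]
    field_simp
    linear_combination -hp

end Demjanenko

theorem corollary2 (ℓ α β m : ℕ) [Fact ℓ.Prime] (hα : 0 < α) (hβ : 0 < β)
    (hm : Nat.gcd m 6 = 1) (hℓ : ℓ - 1 = 2 ^ α * 3 ^ β * m)
    (hlarge : 441 * 2 ^ (4 * α) * β ^ 4 < ℓ) :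
    0 < (Demjanenko.K ℓ).ncard := by
  classical
  have hfin : (Demjanenko.K ℓ).Finite := (Set.finite_Iic (ℓ - 2)).subset fun k hk => hk.2.1
  rw [Set.ncard_pos hfin]
  have hlarge' : 441 * 2 ^ (4 * α) < ℓ :=
    (Nat.le_mul_of_pos_right _ (pow_pos hβ 4)).trans_lt hlarge
  obtain ⟨a, rfl⟩ : ∃ a, α = a + 1 := ⟨α - 1, by omega⟩
  obtain ⟨b, rfl⟩ : ∃ b, β = b + 1 := ⟨β - 1, by omega⟩
  -- The full power of 2 makes χ odd, and the factor 3 puts the sixth roots of unity among its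
  -- values.
  set n := 3 * 2 ^ (a + 1) with hn
  have ha1 : 1 ≤ 2 ^ a := Nat.one_le_two_pow
  have hn6 : 6 ≤ n := by rw [hn, pow_succ]; omega
  have hℓ2 : ℓ ≠ 2 := by
    have : 1 ≤ 2 ^ (4 * (a + 1)) := Nat.one_le_two_pow
    omega
  have hdvd : n ∣ ℓ - 1 := ⟨3 ^ b * m, by rw [hℓ, hn]; ring⟩
  have hm2 : ¬2 ∣ m := by
    intro h
    have h6 : 2 ∣ Nat.gcd m 6 := Nat.dvd_gcd h (by norm_num)
    rw [hm] at h6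
    omega
  have hndvd : ¬n ∣ (ℓ - 1) / 2 := by
    have hhalf : (ℓ - 1) / 2 = 2 ^ a * (3 ^ (b + 1) * m) := by
      rw [hℓ, pow_succ 2 a]
      exact Nat.div_eq_of_eq_mul_left two_pos (by ring)
    rw [hhalf]
    intro h
    have h1 : 2 ^ a * 2 ∣ 2 ^ a * (3 ^ (b + 1) * m) := (Dvd.intro_left 3 (by rw [hn]; ring)).trans h
    have h2 := Nat.dvd_of_mul_dvd_mul_left (by omega) h1
    rcases (Nat.Prime.dvd_mul Nat.prime_two).1 h2 with h3 | h3
    · have := Nat.Prime.dvd_of_dvd_pow Nat.prime_two h3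
      omega
    · exact hm2 h3
  obtain ⟨χ, hχ⟩ := MulChar.exists_mulChar_orderOf (ZMod ℓ) (R := ℂ) (n := n)
    (by rwa [ZMod.card]) (Complex.isPrimitiveRoot_exp n (by omega))
  have hodd : DirichletCharacter.Odd χ := Demjanenko.odd_of_orderOf hχ hndvd hℓ2
  obtain ⟨p, hp⟩ := Demjanenko.exists_sixth_root
  have hpn : p ^ n = 1 := by
    have h6 : p ^ 6 = 1 := by
      linear_combination (p ^ 4 + p ^ 3 - p - 1) * hp
    rw [show n = 6 * 2 ^ a by rw [hn]; ring, pow_mul, h6, one_pow]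
  have hcard := Demjanenko.le_sq_mul_card_filter (by omega) hχ hpn
    (show p⁻¹ ^ n = 1 by rw [inv_pow, hpn, inv_one])
  set S := Finset.univ.filter fun y : ZMod ℓ => χ y = p ∧ χ (1 - y) = p⁻¹ with hS
  have hS2 : 2 < S.card := by
    by_contra! hle
    have hle' : (S.card : ℝ) ≤ 2 := by exact_mod_cast hle
    have hnR : (6 : ℝ) ≤ n := by exact_mod_cast hn6
    -- Since n⁴ = 81·2^(4α) and 441 = 49·9, this says n² < (3/7)√ℓ, which makes a count of at most 2
    -- incompatible with the lower bound.
    have hbig : 49 * n ^ 4 < 9 * ℓ := by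
      calc 49 * n ^ 4 = 9 * (441 * 2 ^ (4 * (a + 1))) := by rw [hn]; ring
        _ < 9 * ℓ := by omega
    have hbig' : (49 : ℝ) * n ^ 4 < 9 * ℓ := by exact_mod_cast hbig
    have hsq : √(ℓ : ℝ) ^ 2 = ℓ := Real.sq_sqrt (Nat.cast_nonneg ℓ)
    set r := √(ℓ : ℝ) with hr
    have hr0 : 0 ≤ r := Real.sqrt_nonneg _
    set N : ℝ := (n : ℝ) ^ 2 with hN
    have hN36 : 36 ≤ N := by nlinarith
    have hrN : 7 * N < 3 * r := by
      refine lt_of_pow_lt_pow_left₀ 2 (by positivity) ?_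
      rw [mul_pow, mul_pow, hsq, hN]
      linarith
    have h1 : N * S.card ≤ N * 2 := mul_le_mul_of_nonneg_left hle' (by linarith)
    have h2 : N * r ≤ r * (r * (3 / 7)) := by nlinarith
    nlinarith
  obtain ⟨y, hyS, hy3⟩ := Demjanenko.exists_mem_sq_sub_add_one_ne_zero hS2
  obtain ⟨-, hy, hy'⟩ := Finset.mem_filter.1 hyS
  exact ⟨_, Demjanenko.mem_K_of_character hℓ2 hodd hp hy hy' hy3⟩
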